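/- For $\psi:\mathbb{N}\to[0,\infty)$ and $\gamma\in\mathbb{R}$, let \[ A_{2,1}^{\psi,\gamma}=\Big\{(\alpha_1,\alpha_2)\in(\mathbb{R}/\mathbb{Z})^2:\ |q_1\alpha_1+q_2\alpha_2+p-\gamma|\le\psi\big(\max(|q_1|,|q_2|)\big)\ \text{for infinitely many }(q_1,q_2,p)\in\mathbb{Z}^3\Big\} \] (whether the condition holds does not depend on the choice of real representatives of $\alpha_1,\alpha_2$, nor on the value $\psi(0)$ given to $q_1=q_2=0$). Let $\gamma$ be an irrational real number that is not a Liouville number, and let $\psi:\mathbb{N}\to[0,\infty)$ be arbitrary (no monotonicity is assumed). Then the $2$-dimensional Lebesgue (normalized Haar) measure $\lambda_2$ on $(\mathbb{R}/\mathbb{Z})^2$ satisfies \[ \lambda_2\big(A_{2,1}^{\psi,\gamma}\big)=\begin{cases}0&\text{if }\sum_{q\in\mathbb{N}}q\,\psi(q)<\infty,\\ 1&\text{if }\sum_{q\in\mathbb{N}}q\,\psi(q)=\infty.\end{cases} \] -/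

import Mathlib

open MeasureTheory
open scoped NNReal

/-- The maximum norm `|q| = max_i |q_i|` of an integer vector, as a natural number. -/
def intVecNorm {n : ℕ} (q : Fin n → ℤ) : ℕ :=
  Finset.univ.sup fun i => (q i).natAbs

/-- The integer solutions `(q, p) ∈ ℤ^n × ℤ^m` of `|q a + p - γ| ≤ ψ(|q|)`, for a real
`n × m` matrix `a`; the norm on `Fin m → ℝ` is the maximum norm. -/
def approxSolutions (n m : ℕ) (ψ : ℕ → ℝ≥0) (γ : Fin m → ℝ) (a : Fin n → Fin m → ℝ) :
    Set ((Fin n → ℤ) × (Fin m → ℤ)) :=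
  {qp | ‖fun j : Fin m => (∑ i, (qp.1 i : ℝ) * a i j) + (qp.2 j : ℝ) - γ j‖
    ≤ (ψ (intVecNorm qp.1) : ℝ)}

/-- The set of `α` in the torus `(ℝ/ℤ)^(n × m)` such that `|q α + p - γ| ≤ ψ(|q|)` for infinitely
many `(q, p) ∈ ℤ^n × ℤ^m`. Here `α` is read through a real matrix representing it; the choice of
the representative does not matter, see `mem_approxSet_iff_forall`. -/
def approxSet (n m : ℕ) (ψ : ℕ → ℝ≥0) (γ : Fin m → ℝ) : Set (Fin n → Fin m → UnitAddCircle) :=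
  {α | ∃ a : Fin n → Fin m → ℝ,
    (∀ i j, (a i j : UnitAddCircle) = α i j) ∧ (approxSolutions n m ψ γ a).Infinite}

/-- Changing a real matrix by an integer matrix keeps infinitely many solutions. -/
theorem approxSolutions_infinite_of_coe_eq {n m : ℕ} {ψ : ℕ → ℝ≥0} {γ : Fin m → ℝ}
    {a b : Fin n → Fin m → ℝ}
    (hab : ∀ i j, (a i j : UnitAddCircle) = (b i j : UnitAddCircle))
    (ha : (approxSolutions n m ψ γ a).Infinite) : (approxSolutions n m ψ γ b).Infinite := by
  have h : ∀ i j, ∃ k : ℤ, a i j = b i j + k := by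
    intro i j
    obtain ⟨k, hk⟩ := (QuotientAddGroup.eq_iff_sub_mem.1 (hab i j))
    exact ⟨k, by simp at hk; linarith⟩
  choose k hk using h
  let f : (Fin n → ℤ) × (Fin m → ℤ) → (Fin n → ℤ) × (Fin m → ℤ) :=
    fun qp => (qp.1, fun j => qp.2 j + ∑ i, qp.1 i * k i j)
  have hf : Function.Injective f := by
    rintro ⟨q, p⟩ ⟨q', p'⟩ h
    simp only [f, Prod.mk.injEq] at h
    obtain ⟨rfl, h⟩ := h
    refine Prod.ext rfl (funext fun j => ?_)
    simpa using congrFun h j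
  refine (ha.image hf.injOn).mono ?_
  rintro _ ⟨⟨q, p⟩, hqp, rfl⟩
  simp only [approxSolutions, Set.mem_ofPred_eq, f] at hqp ⊢
  convert hqp using 3 with j
  simp only [hk, mul_add, Finset.sum_add_distrib]
  push_cast
  ring

/-- Membership can be tested on every real matrix that represents `α`. -/
theorem mem_approxSet_iff_forall {n m : ℕ} {ψ : ℕ → ℝ≥0} {γ : Fin m → ℝ}
    {α : Fin n → Fin m → UnitAddCircle} :
    α ∈ approxSet n m ψ γ ↔ ∀ a : Fin n → Fin m → ℝ,
      (∀ i j, (a i j : UnitAddCircle) = α i j) → (approxSolutions n m ψ γ a).Infinite := by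
  constructor
  · rintro ⟨a, ha, hinf⟩ b hb
    exact approxSolutions_infinite_of_coe_eq (fun i j => (ha i j).trans (hb i j).symm) hinf
  · intro h
    choose a ha using fun i j => QuotientAddGroup.mk_surjective (α i j)
    exact ⟨a, ha, h a ha⟩

/-! Convergence is Borel–Cantelli: O(n) vectors have norm n, each resonant set having measure at
most 2ψ(n).

For divergence, keep only q = (n, j) with 1 ≤ j ≤ n and bound the second moment of the counting
function. Non-parallel vectors give independent events. A parallel pair is n'r, m'r with n', m'
coprime, so its overlap lives on one circle. Writing g = gcd(n, m), it exceeds the independent value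
by at most O(φ(n) g / n), and summing over the at most g parallel pairs produces g². Over all m ≤ n
the sum of g² is not O(n²); here γ enters. If the overlap is nonempty, (n' - m')γ is close to an
integer, which for non-Liouville γ forces n/g to be at least a power of n. The divisor bound then
restores O(n²).

So the second moment is at most μ² + Cμ, with μ the first moment. Since μ → ∞,
`sq_sum_measureReal_le` makes every tail union of full measure; no zero-one law is needed. -/

instance unitAddCircle_isProbabilityMeasure :
    IsProbabilityMeasure (volume : Measure UnitAddCircle) :=
  ⟨by simp⟩

instance torus_isAddHaarMeasure :
    (volume : Measure (Fin 2 → Fin 1 → UnitAddCircle)).IsAddHaarMeasure := by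
  have : (volume : Measure (Fin 1 → UnitAddCircle)).IsAddHaarMeasure :=
    Measure.pi.isAddHaarMeasure _
  exact Measure.pi.isAddHaarMeasure _

instance torus_isProbabilityMeasure :
    IsProbabilityMeasure (volume : Measure (Fin 2 → Fin 1 → UnitAddCircle)) := by
  have : IsProbabilityMeasure (volume : Measure (Fin 1 → UnitAddCircle)) :=
    Measure.pi.instIsProbabilityMeasure _
  exact Measure.pi.instIsProbabilityMeasure _

instance unitAddCircle_prod_isAddHaarMeasure :
    (volume : Measure (UnitAddCircle × UnitAddCircle)).IsAddHaarMeasure :=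
  Measure.prod.instIsAddHaarMeasure _ _

theorem norm_coe_unitAddCircle_le_iff {x δ : ℝ} :
    ‖(x : UnitAddCircle)‖ ≤ δ ↔ ∃ p : ℤ, |x + p| ≤ δ := by
  rw [UnitAddCircle.norm_eq]
  constructor
  · intro h
    exact ⟨-round x, by push_cast; simpa [sub_eq_add_neg] using h⟩
  · rintro ⟨p, hp⟩
    have := round_le x (-p)
    push_cast at this
    rw [sub_neg_eq_add] at this
    exact this.trans hp

/-! ### Linear forms and resonant sets -/

/-- The linear form `α ↦ q · α` on the two-dimensional torus. -/
def linForm (q : Fin 2 → ℤ) : (Fin 2 → Fin 1 → UnitAddCircle) →+ UnitAddCircle where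
  toFun α := q 0 • α 0 0 + q 1 • α 1 0
  map_zero' := by simp
  map_add' α β := by simp only [Pi.add_apply, smul_add]; abel

theorem linForm_apply (q : Fin 2 → ℤ) (α : Fin 2 → Fin 1 → UnitAddCircle) :
    linForm q α = q 0 • α 0 0 + q 1 • α 1 0 := rfl

theorem continuous_linForm (q : Fin 2 → ℤ) : Continuous (linForm q) := by
  change Continuous fun α : Fin 2 → Fin 1 → UnitAddCircle => q 0 • α 0 0 + q 1 • α 1 0
  fun_prop

/-- Cramer's rule on real lifts. -/
theorem linForm_prod_surjective {q r : Fin 2 → ℤ} (h : q 0 * r 1 - q 1 * r 0 ≠ 0) :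
    Function.Surjective ((linForm q).prod (linForm r)) := by
  rintro ⟨x, y⟩
  obtain ⟨x, rfl⟩ := QuotientAddGroup.mk_surjective x
  obtain ⟨y, rfl⟩ := QuotientAddGroup.mk_surjective y
  have hD : ((q 0 : ℝ) * r 1 - q 1 * r 0) ≠ 0 := by exact_mod_cast h
  refine ⟨fun i _ => if i = 0
    then (((x * r 1 - y * q 1) / (q 0 * r 1 - q 1 * r 0) : ℝ) : UnitAddCircle)
    else (((y * q 0 - x * r 0) / (q 0 * r 1 - q 1 * r 0) : ℝ) : UnitAddCircle), ?_⟩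
  simp only [AddMonoidHom.prod_apply, linForm_apply, Prod.mk.injEq, if_true, one_ne_zero, if_false]
  constructor
  · rw [← AddCircle.coe_zsmul, ← AddCircle.coe_zsmul, ← AddCircle.coe_add]
    congr 1
    simp only [zsmul_eq_mul]
    rw [← mul_div_assoc, ← mul_div_assoc, ← add_div, div_eq_iff hD]
    ring
  · rw [← AddCircle.coe_zsmul, ← AddCircle.coe_zsmul, ← AddCircle.coe_add]
    congr 1
    simp only [zsmul_eq_mul]
    rw [← mul_div_assoc, ← mul_div_assoc, ← add_div, div_eq_iff hD]
    ring

theorem linForm_surjective {q : Fin 2 → ℤ} (h : q ≠ 0) : Function.Surjective (linForm q) := by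
  have hq : q 0 * q 0 - q 1 * (-q 1) ≠ 0 := by
    intro h0
    have h1 : q 0 = 0 := by nlinarith [mul_self_nonneg (q 0), mul_self_nonneg (q 1)]
    have h2 : q 1 = 0 := by nlinarith [mul_self_nonneg (q 0), mul_self_nonneg (q 1)]
    exact h (funext fun i => by fin_cases i <;> simpa)
  intro x
  -- Rotating q by a right angle gives a partner with determinant q₀² + q₁².
  obtain ⟨α, hα⟩ := linForm_prod_surjective (q := q) (r := ![-q 1, q 0]) (by simpa using hq) (x, 0)
  exact ⟨α, congrArg Prod.fst hα⟩

theorem measurePreserving_linForm {q : Fin 2 → ℤ} (h : q ≠ 0) :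
    MeasurePreserving (linForm q) volume volume :=
  AddMonoidHom.measurePreserving (continuous_linForm q) (linForm_surjective h) (by simp)

theorem measurePreserving_linForm_prod {q r : Fin 2 → ℤ} (h : q 0 * r 1 - q 1 * r 0 ≠ 0) :
    MeasurePreserving ((linForm q).prod (linForm r)) volume volume :=
  AddMonoidHom.measurePreserving ((continuous_linForm q).prodMk (continuous_linForm r))
    (linForm_prod_surjective h) (by
      rw [measure_univ, Measure.volume_eq_prod, measure_univ])

/-- The points of the torus at which `q · α` lies within `δ` of `γ` modulo one. -/
def resonantSet (γ : ℝ) (δ : ℝ) (q : Fin 2 → ℤ) : Set (Fin 2 → Fin 1 → UnitAddCircle) :=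
  linForm q ⁻¹' Metric.closedBall (γ : UnitAddCircle) δ

theorem measurableSet_resonantSet (γ δ : ℝ) (q : Fin 2 → ℤ) :
    MeasurableSet (resonantSet γ δ q) :=
  (continuous_linForm q).measurable Metric.isClosed_closedBall.measurableSet

theorem volume_resonantSet (γ δ : ℝ) {q : Fin 2 → ℤ} (h : q ≠ 0) :
    volume (resonantSet γ δ q) = ENNReal.ofReal (min 1 (2 * δ)) := by
  rw [resonantSet, (measurePreserving_linForm h).measure_preimage
    Metric.isClosed_closedBall.measurableSet.nullMeasurableSet, AddCircle.volume_closedBall]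

/-- Independence: a continuous surjective homomorphism of compact groups carries Haar measure to
Haar measure. -/
theorem volume_resonantSet_inter (γ δ ε : ℝ) {q r : Fin 2 → ℤ}
    (h : q 0 * r 1 - q 1 * r 0 ≠ 0) :
    volume (resonantSet γ δ q ∩ resonantSet γ ε r) =
      ENNReal.ofReal (min 1 (2 * δ)) * ENNReal.ofReal (min 1 (2 * ε)) := by
  have h1 : resonantSet γ δ q ∩ resonantSet γ ε r = ((linForm q).prod (linForm r)) ⁻¹'
      (Metric.closedBall (γ : UnitAddCircle) δ ×ˢ Metric.closedBall (γ : UnitAddCircle) ε) := rfl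
  rw [h1, (measurePreserving_linForm_prod h).measure_preimage
    (Metric.isClosed_closedBall.measurableSet.prod
      Metric.isClosed_closedBall.measurableSet).nullMeasurableSet,
    Measure.volume_eq_prod, Measure.prod_prod, AddCircle.volume_closedBall,
    AddCircle.volume_closedBall]

/-! ### The approximable set as a limsup of resonant sets -/

theorem intVecNorm_two (q : Fin 2 → ℤ) : intVecNorm q = max (q 0).natAbs (q 1).natAbs := by
  simp [intVecNorm, Fin.univ_succ]

theorem linForm_coe (q : Fin 2 → ℤ) {a : Fin 2 → Fin 1 → ℝ}
    {α : Fin 2 → Fin 1 → UnitAddCircle} (h : ∀ i j, (a i j : UnitAddCircle) = α i j) :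
    linForm q α = ((q 0 * a 0 0 + q 1 * a 1 0 : ℝ) : UnitAddCircle) := by
  rw [linForm_apply, ← h, ← h, ← AddCircle.coe_zsmul, ← AddCircle.coe_zsmul, ← AddCircle.coe_add]
  simp

theorem mem_approxSolutions_iff {ψ : ℕ → ℝ≥0} {γ : ℝ} {a : Fin 2 → Fin 1 → ℝ}
    {q : Fin 2 → ℤ} {p : Fin 1 → ℤ} :
    (q, p) ∈ approxSolutions 2 1 ψ (fun _ => γ) a ↔
      |q 0 * a 0 0 + q 1 * a 1 0 - γ + p 0| ≤ ψ (intVecNorm q) := by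
  simp only [approxSolutions, Set.mem_ofPred_eq, Fin.sum_univ_two]
  rw [pi_norm_le_iff_of_nonneg (by positivity)]
  simp only [Real.norm_eq_abs, Fin.forall_fin_one]
  rw [add_sub_right_comm]

theorem mem_resonantSet_coe_iff {γ δ : ℝ} {q : Fin 2 → ℤ} {a : Fin 2 → Fin 1 → ℝ}
    {α : Fin 2 → Fin 1 → UnitAddCircle} (h : ∀ i j, (a i j : UnitAddCircle) = α i j) :
    α ∈ resonantSet γ δ q ↔ ∃ p : ℤ, |q 0 * a 0 0 + q 1 * a 1 0 - γ + p| ≤ δ := by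
  rw [resonantSet, Set.mem_preimage, mem_closedBall_iff_norm, linForm_coe q h,
    ← AddCircle.coe_sub, norm_coe_unitAddCircle_le_iff]

theorem mem_approxSet_of_frequently {ψ : ℕ → ℝ≥0} {γ : ℝ} {α : Fin 2 → Fin 1 → UnitAddCircle}
    (h : ∀ N : ℕ, ∃ q, N ≤ intVecNorm q ∧ α ∈ resonantSet γ (ψ (intVecNorm q)) q) :
    α ∈ approxSet 2 1 ψ fun _ => γ := by
  choose a ha using fun i j => QuotientAddGroup.mk_surjective (α i j)
  refine ⟨a, ha, Set.Infinite.of_image (fun qp => intVecNorm qp.1) ?_⟩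
  refine Set.infinite_of_forall_exists_gt fun N => ?_
  obtain ⟨q, hN, hq⟩ := h (N + 1)
  obtain ⟨p, hp⟩ := (mem_resonantSet_coe_iff ha).1 hq
  exact ⟨_, ⟨(q, fun _ => p), mem_approxSolutions_iff.2 hp, rfl⟩, hN⟩

theorem finite_intVecNorm_le (N : ℕ) : {q : Fin 2 → ℤ | intVecNorm q ≤ N}.Finite := by
  refine (Set.finite_Icc (fun _ => -(N : ℤ)) (fun _ => (N : ℤ))).subset fun q hq => ?_
  simp only [Set.mem_ofPred_eq, intVecNorm, Finset.sup_le_iff, Finset.mem_univ, true_imp_iff] at hq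
  exact ⟨fun i => by have := hq i; dsimp; omega, fun i => by have := hq i; dsimp; omega⟩

/-- Each q admits finitely many p, so infinitely many solutions force the norms of q to be
unbounded. -/
theorem frequently_of_mem_approxSet {ψ : ℕ → ℝ≥0} {γ : ℝ} {α : Fin 2 → Fin 1 → UnitAddCircle}
    (h : α ∈ approxSet 2 1 ψ fun _ => γ) :
    ∃ᶠ n : ℕ in Filter.atTop, ∃ q, intVecNorm q = n ∧ α ∈ resonantSet γ (ψ n) q := by
  obtain ⟨a, ha, hinf⟩ := h
  rw [Filter.frequently_atTop]
  intro N
  by_contra! hN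
  refine hinf (Set.Finite.subset (((finite_intVecNorm_le N).biUnion (t := fun q =>
    (fun p : Fin 1 → ℤ => (q, p)) '' Set.Icc
      (fun _ => ⌈-(q 0 * a 0 0 + q 1 * a 1 0 - γ) - ψ (intVecNorm q)⌉)
      (fun _ => ⌊-(q 0 * a 0 0 + q 1 * a 1 0 - γ) + ψ (intVecNorm q)⌋))
    fun q _ => (Set.finite_Icc _ _).image _)) ?_)
  rintro ⟨q, p⟩ hqp
  rw [mem_approxSolutions_iff] at hqp
  have hq : intVecNorm q ≤ N := by
    by_contra! hlt
    exact hN _ hlt.le q rfl ((mem_resonantSet_coe_iff ha).2 ⟨_, hqp⟩)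
  refine Set.mem_biUnion hq ⟨p, ⟨fun i => ?_, fun i => ?_⟩, rfl⟩
  · rw [Subsingleton.elim i 0, Int.ceil_le]
    linarith [(abs_le.1 hqp).1]
  · rw [Subsingleton.elim i 0, Int.le_floor]
    linarith [(abs_le.1 hqp).2]

/-! ### The convergence case -/

theorem volume_iUnion_resonantSet_le (γ δ : ℝ) {n : ℕ} (hn : n ≠ 0) :
    volume {α | ∃ q, intVecNorm q = n ∧ α ∈ resonantSet γ δ q} ≤
      ENNReal.ofReal (24 * n * δ) := by
  let box : Finset (ℤ × ℤ) := ({(n : ℤ), -(n : ℤ)} : Finset ℤ) ×ˢ Finset.Icc (-(n : ℤ)) n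
  have hcard : box.card ≤ 2 * (2 * n + 1) := by
    rw [Finset.card_product]
    refine Nat.mul_le_mul Finset.card_le_two ?_
    simp only [Int.card_Icc]
    omega
  have hsub : {α | ∃ q, intVecNorm q = n ∧ α ∈ resonantSet γ δ q} ⊆
      (⋃ b ∈ box, resonantSet γ δ ![b.1, b.2]) ∪ ⋃ b ∈ box, resonantSet γ δ ![b.2, b.1] := by
    rintro α ⟨q, hq, hα⟩
    rw [intVecNorm_two] at hq
    have hq' : q = ![q 0, q 1] := List.ofFn_inj.mp rfl
    rcases le_total (q 0).natAbs (q 1).natAbs with h | h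
    · refine Or.inr (Set.mem_biUnion (x := (q 1, q 0)) ?_ (by rwa [hq'] at hα))
      simp only [box, Finset.coe_product, Set.mem_prod, Finset.mem_coe, Finset.mem_insert,
        Finset.mem_singleton, Finset.mem_Icc]
      omega
    · refine Or.inl (Set.mem_biUnion (x := (q 0, q 1)) ?_ (by rwa [hq'] at hα))
      simp only [box, Finset.coe_product, Set.mem_prod, Finset.mem_coe, Finset.mem_insert,
        Finset.mem_singleton, Finset.mem_Icc]
      omega
  have hvol : ∀ q : Fin 2 → ℤ, q ≠ 0 →
      volume (resonantSet γ δ q) ≤ ENNReal.ofReal (2 * δ) := fun q hq => by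
    rw [volume_resonantSet γ δ hq]
    exact ENNReal.ofReal_le_ofReal (min_le_right _ _)
  have hne : ∀ b ∈ box, b.1 ≠ 0 := by
    intro b hb
    simp only [box, Finset.mem_product, Finset.mem_insert, Finset.mem_singleton] at hb
    omega
  have h1 : volume (⋃ b ∈ box, resonantSet γ δ ![b.1, b.2]) ≤
      box.card • ENNReal.ofReal (2 * δ) :=
    (measure_biUnion_finset_le _ _).trans (Finset.sum_le_card_nsmul _ _ _ fun b hb =>
      hvol _ fun h0 => hne b hb (congrFun h0 0))
  have h2 : volume (⋃ b ∈ box, resonantSet γ δ ![b.2, b.1]) ≤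
      box.card • ENNReal.ofReal (2 * δ) :=
    (measure_biUnion_finset_le _ _).trans (Finset.sum_le_card_nsmul _ _ _ fun b hb =>
      hvol _ fun h0 => hne b hb (congrFun h0 1))
  calc _ ≤ _ := measure_mono hsub
    _ ≤ _ := measure_union_le _ _
    _ ≤ box.card • ENNReal.ofReal (2 * δ) + box.card • ENNReal.ofReal (2 * δ) := add_le_add h1 h2
    _ = (2 * box.card) • ENNReal.ofReal (2 * δ) := by rw [two_mul box.card, add_nsmul]
    _ ≤ (12 * n) • ENNReal.ofReal (2 * δ) := by
        refine nsmul_le_nsmul_left (by positivity) ?_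
        omega
    _ = ENNReal.ofReal (24 * n * δ) := by
        rw [← ENNReal.ofReal_nsmul]
        congr 1
        simp only [nsmul_eq_mul]
        push_cast
        ring

theorem volume_approxSet_eq_zero (γ : ℝ) {ψ : ℕ → ℝ≥0}
    (h : Summable fun q : ℕ => (q : ℝ≥0) * ψ q) : volume (approxSet 2 1 ψ fun _ => γ) = 0 := by
  have hfreq : volume {α | ∃ᶠ n : ℕ in Filter.atTop,
      n ≠ 0 ∧ ∃ q, intVecNorm q = n ∧ α ∈ resonantSet γ (ψ n) q} = 0 := by
    refine measure_setOfPred_frequently_eq_zero (ne_top_of_le_ne_top (b :=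
      ∑' n : ℕ, ((24 * ((n : ℝ≥0) * ψ n) : ℝ≥0) : ENNReal)) ?_ (ENNReal.tsum_le_tsum fun n => ?_))
    · exact ENNReal.tsum_coe_ne_top_iff_summable.2 (h.mul_left 24)
    · rcases eq_or_ne n 0 with rfl | hn
      · simp
      · simp only [ne_eq, hn, not_false_eq_true, true_and]
        refine (volume_iUnion_resonantSet_le γ (ψ n) hn).trans (le_of_eq ?_)
        rw [ENNReal.ofReal, mul_assoc]
        congr 1
        ext
        rw [Real.coe_toNNReal _ (by positivity)]
        push_cast
        ring
  refine measure_mono_null (fun α hα => ?_) hfreq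
  exact ((frequently_of_mem_approxSet hα).and_eventually (Filter.eventually_ne_atTop 0)).mono
    fun n hn => ⟨hn.2, hn.1⟩

/-! ### Overlaps on the circle -/

/-- After multiplying by n, a good shift i gives an integer m i + n p in an interval of length 2nε.
By coprimality these integers are distinct mod n. -/
theorem card_shifts_le {m n : ℕ} (hn : 0 < n) (hmn : Nat.Coprime n m) (γ ε : ℝ) (hε : 0 ≤ ε)
    (θ : UnitAddCircle) :
    (((Finset.range n).filter fun i : ℕ =>
      ‖m • (θ + ((i / n : ℝ) : UnitAddCircle)) - (γ : UnitAddCircle)‖ ≤ ε).card : ℝ) ≤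
        2 * n * ε + 1 := by
  obtain ⟨t, rfl⟩ := QuotientAddGroup.mk_surjective θ
  have hn' : (0 : ℝ) < n := by exact_mod_cast hn
  have hlift : ∀ i : ℕ, ∃ p : ℤ,
      ‖m • ((t : UnitAddCircle) + ((i / n : ℝ) : UnitAddCircle)) - (γ : UnitAddCircle)‖ ≤ ε →
        |m * (t + i / n) - γ + p| ≤ ε := by
    intro i
    by_cases h : ‖m • ((t : UnitAddCircle) + ((i / n : ℝ) : UnitAddCircle)) -
        (γ : UnitAddCircle)‖ ≤ ε
    · have h' := h
      rw [← AddCircle.coe_add, ← AddCircle.coe_nsmul, ← AddCircle.coe_sub,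
        norm_coe_unitAddCircle_le_iff] at h'
      obtain ⟨p, hp⟩ := h'
      exact ⟨p, fun _ => by rwa [nsmul_eq_mul] at hp⟩
    · exact ⟨0, fun h' => absurd h' h⟩
  choose p hp using hlift
  set x : ℝ := n * γ - n * m * t with hx
  have hcard := Finset.card_le_card_of_injOn (s := (Finset.range n).filter fun i : ℕ =>
      ‖m • ((t : UnitAddCircle) + ((i / n : ℝ) : UnitAddCircle)) - (γ : UnitAddCircle)‖ ≤ ε)
    (t := Finset.Icc ⌈x - n * ε⌉ ⌊x + n * ε⌋) (fun i => m * i + n * p i) ?_ ?_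
  · refine (Nat.cast_le.2 hcard).trans ?_
    rw [Int.card_Icc]
    have h1 := Int.floor_le (x + n * ε)
    have h2 := Int.le_ceil (x - n * ε)
    have h3 : (((⌊x + n * ε⌋ + 1 - ⌈x - n * ε⌉).toNat : ℤ) : ℝ) ≤ 2 * n * ε + 1 := by
      rw [Int.toNat_eq_max]
      push_cast
      exact max_le (by linarith) (by positivity)
    exact_mod_cast h3
  · intro i hi
    have hi := hp i (Finset.mem_filter.1 hi).2
    have h2 : |(m * i + n * p i : ℝ) - x| ≤ n * ε := by
      have : (m * i + n * p i : ℝ) - x = n * (m * (t + i / n) - γ + p i) := by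
        rw [hx]; field_simp; ring
      rw [this, abs_mul, abs_of_pos hn']
      exact mul_le_mul_of_nonneg_left hi hn'.le
    rw [abs_le] at h2
    simp only [Finset.coe_Icc, Set.mem_Icc, Int.ceil_le, Int.le_floor]
    push_cast
    constructor <;> linarith [h2.1, h2.2]
  · intro i hi j hj hij
    have hi := Finset.mem_range.1 (Finset.mem_filter.1 hi).1
    have hj := Finset.mem_range.1 (Finset.mem_filter.1 hj).1
    have hdvd : (n : ℤ) ∣ m * (i - j) := ⟨p j - p i, by linarith⟩
    have hdvd' : (n : ℤ) ∣ i - j := (Nat.isCoprime_iff_coprime.2 hmn).dvd_of_dvd_mul_left hdvd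
    have := Int.eq_zero_of_abs_lt_dvd hdvd' (by rw [abs_lt]; constructor <;> omega)
    omega

theorem volume_real_closedBall_le (x : UnitAddCircle) {δ : ℝ} (hδ : 0 ≤ δ) :
    volume.real (Metric.closedBall x δ) ≤ 2 * δ := by
  rw [Measure.real, AddCircle.volume_closedBall, ENNReal.toReal_ofReal (by positivity)]
  exact min_le_right _ _

theorem measurePreserving_nsmul {n : ℕ} (hn : 0 < n) :
    MeasurePreserving (fun θ : UnitAddCircle => n • θ) volume volume := by
  refine AddMonoidHom.measurePreserving (f := nsmulAddMonoidHom (α := UnitAddCircle) n) ?_ ?_ rfl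
  · exact continuous_nsmul n
  intro x
  obtain ⟨t, rfl⟩ := QuotientAddGroup.mk_surjective x
  refine ⟨((t / n : ℝ) : UnitAddCircle), ?_⟩
  rw [nsmulAddMonoidHom_apply, ← AddCircle.coe_nsmul]
  congr 1
  rw [nsmul_eq_mul]
  field_simp

/-- The points `θ` of the circle with `n θ` within `δ` of `γ` and `m θ` within `ε` of `γ`. -/
def circleOverlap (γ : ℝ) (n m : ℕ) (δ ε : ℝ) : Set UnitAddCircle :=
  (fun θ => n • θ) ⁻¹' Metric.closedBall (γ : UnitAddCircle) δ ∩
    (fun θ => m • θ) ⁻¹' Metric.closedBall (γ : UnitAddCircle) ε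

theorem measurableSet_circleOverlap (γ : ℝ) (n m : ℕ) (δ ε : ℝ) :
    MeasurableSet (circleOverlap γ n m δ ε) :=
  ((continuous_nsmul n).measurable Metric.isClosed_closedBall.measurableSet).inter
    ((continuous_nsmul m).measurable Metric.isClosed_closedBall.measurableSet)

/-- Average over the translations by i/n: they preserve the condition on nθ, while `card_shifts_le`
bounds how many satisfy the one on mθ. -/
theorem volume_circleOverlap_le {n m : ℕ} (hn : 0 < n) (hnm : Nat.Coprime n m) (γ : ℝ)
    {δ ε : ℝ} (hδ : 0 ≤ δ) (hε : 0 ≤ ε) :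
    n * volume.real (circleOverlap γ n m δ ε) ≤ (2 * n * ε + 1) * (2 * δ) := by
  set S := circleOverlap γ n m δ ε with hS
  set A : Set UnitAddCircle := (fun θ => n • θ) ⁻¹' Metric.closedBall (γ : UnitAddCircle) δ with hA
  have hSm : MeasurableSet S := measurableSet_circleOverlap γ n m δ ε
  have hAm : MeasurableSet A :=
    (continuous_nsmul n).measurable Metric.isClosed_closedBall.measurableSet
  let τ : ℕ → UnitAddCircle := fun i => ((i / n : ℝ) : UnitAddCircle)
  have hτ : ∀ i, n • τ i = 0 := fun i => by
    rw [← AddCircle.coe_nsmul, AddCircle.coe_eq_zero_iff]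
    exact ⟨i, by simp only [nsmul_eq_mul, zsmul_eq_mul]; push_cast; field_simp⟩
  let Si : ℕ → Set UnitAddCircle := fun i => (fun θ => θ + τ i) ⁻¹' S
  have hSim : ∀ i, MeasurableSet (Si i) := fun i => (measurable_add_const (τ i)) hSm
  have hvol : ∀ i, volume.real (Si i) = volume.real S := fun i => by
    simp only [Measure.real, Si, measure_preimage_add_right]
  have hpt : ∀ θ, ∑ i ∈ Finset.range n, (Si i).indicator (fun _ => (1 : ℝ)) θ ≤
      A.indicator (fun _ => 2 * n * ε + 1) θ := by
    intro θ
    have hmem : ∀ i, θ ∈ Si i ↔ θ ∈ A ∧ ‖m • (θ + τ i) - (γ : UnitAddCircle)‖ ≤ ε := fun i => by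
      simp only [Si, hS, hA, circleOverlap, Set.mem_preimage, Set.mem_inter_iff, nsmul_add, hτ,
        add_zero, mem_closedBall_iff_norm]
    by_cases hθ : θ ∈ A
    · rw [Set.indicator_of_mem hθ]
      refine le_trans (le_of_eq ?_) (card_shifts_le hn hnm γ ε hε θ)
      rw [Finset.card_filter, Nat.cast_sum]
      refine Finset.sum_congr rfl fun i _ => ?_
      by_cases h : ‖m • (θ + τ i) - (γ : UnitAddCircle)‖ ≤ ε
      · rw [Set.indicator_of_mem ((hmem i).2 ⟨hθ, h⟩), if_pos h, Nat.cast_one]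
      · rw [Set.indicator_of_notMem fun h' => h ((hmem i).1 h').2, if_neg h, Nat.cast_zero]
    · rw [Set.indicator_of_notMem hθ]
      refine (Finset.sum_eq_zero fun i _ => ?_).le
      rw [Set.indicator_of_notMem fun h => hθ ((hmem i).1 h).1]
  have hint : ∫ θ, ∑ i ∈ Finset.range n, (Si i).indicator (fun _ => (1 : ℝ)) θ ≤
      ∫ θ, A.indicator (fun _ => 2 * n * ε + 1) θ :=
    integral_mono (integrable_finsetSum _ fun i _ => (integrable_const _).indicator (hSim i))
      ((integrable_const _).indicator hAm) hpt
  rw [integral_finsetSum _ fun i _ => (integrable_const _).indicator (hSim i)] at hint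
  simp only [integral_indicator_const _ (hSim _), integral_indicator_const _ hAm, hvol,
    Finset.sum_const, Finset.card_range, smul_eq_mul, nsmul_eq_mul, mul_one] at hint
  refine hint.trans ?_
  rw [mul_comm]
  refine mul_le_mul_of_nonneg_left ?_ (by positivity)
  rw [hA, Measure.real, (measurePreserving_nsmul hn).measure_preimage
    Metric.isClosed_closedBall.measurableSet.nullMeasurableSet]
  exact volume_real_closedBall_le _ hδ

/-- Eliminate θ: m(nθ - γ) - n(mθ - γ) = (n - m)γ. -/
theorem exists_int_of_circleOverlap_nonempty {γ : ℝ} {n m : ℕ} {δ ε : ℝ}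
    (h : (circleOverlap γ n m δ ε).Nonempty) :
    ∃ k : ℤ, |(n - m : ℝ) * γ + k| ≤ m * δ + n * ε := by
  obtain ⟨θ, h1, h2⟩ := h
  obtain ⟨t, rfl⟩ := QuotientAddGroup.mk_surjective θ
  rw [Set.mem_preimage, mem_closedBall_iff_norm, ← AddCircle.coe_nsmul, ← AddCircle.coe_sub,
    norm_coe_unitAddCircle_le_iff] at h1 h2
  obtain ⟨p, hp⟩ := h1
  obtain ⟨r, hr⟩ := h2
  rw [nsmul_eq_mul] at hp hr
  refine ⟨m * p - n * r, ?_⟩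
  have hk : (n - m : ℝ) * γ + ((m * p - n * r : ℤ) : ℝ) =
      m * (n * t - γ + p) - n * (m * t - γ + r) := by
    push_cast; ring
  rw [hk]
  refine (abs_sub _ _).trans (add_le_add ?_ ?_)
  · rw [abs_mul, Nat.abs_cast]
    exact mul_le_mul_of_nonneg_left hp m.cast_nonneg
  · rw [abs_mul, Nat.abs_cast]
    exact mul_le_mul_of_nonneg_left hr n.cast_nonneg

/-! ### Divisor bound and gcd sums -/

theorem exists_succ_pow_le_mul_two_pow (K : ℕ) :
    ∃ C : ℕ, 1 ≤ C ∧ ∀ e : ℕ, (e + 1) ^ K ≤ C * 2 ^ e := by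
  have hlim := tendsto_pow_const_div_const_pow_of_one_lt K (r := (2 : ℝ)) one_lt_two
  obtain ⟨B, hB⟩ := hlim.bddAbove_range
  obtain ⟨C, hC⟩ := exists_nat_ge (2 * B)
  refine ⟨C + 1, by omega, fun e => ?_⟩
  have h := hB ⟨e + 1, rfl⟩
  simp only at h
  rw [div_le_iff₀ (by positivity)] at h
  have h2 : ((e + 1 : ℕ) : ℝ) ^ K ≤ (C + 1) * 2 ^ e := by
    refine h.trans ?_
    rw [pow_succ]
    nlinarith [pow_pos (two_pos (α := ℝ)) e]
  exact_mod_cast h2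

/-- The divisor bound: the number of divisors of `n` is `O(n ^ (1 / K))`. -/
theorem exists_card_divisors_pow_le (K : ℕ) :
    ∃ C : ℕ, ∀ n : ℕ, n ≠ 0 → n.divisors.card ^ K ≤ C * n := by
  obtain ⟨C, hC1, hC⟩ := exists_succ_pow_le_mul_two_pow K
  refine ⟨C ^ (2 ^ K), fun n hn => ?_⟩
  rw [Nat.card_divisors hn, ← Finset.prod_pow]
  have hfac : n = ∏ p ∈ n.primeFactors, p ^ n.factorization p :=
    (Nat.prod_factorization_pow_eq_self hn).symm
  -- Only primes below 2 ^ K, fewer than 2 ^ K in number, cost a factor C; for larger p, e + 1 ≤ 2 ^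
  -- e suffices.
  have hterm : ∀ p ∈ n.primeFactors, (n.factorization p + 1) ^ K ≤
      (if p < 2 ^ K then C else 1) * p ^ n.factorization p := by
    intro p hp
    have hp2 := (Nat.prime_of_mem_primeFactors hp).two_le
    split_ifs with h
    · exact (hC _).trans (Nat.mul_le_mul_left _ (Nat.pow_le_pow_left hp2 _))
    · rw [one_mul]
      calc _ ≤ (2 ^ n.factorization p) ^ K :=
            Nat.pow_le_pow_left (Nat.lt_two_pow_self (n := n.factorization p)) _
        _ = (2 ^ K) ^ n.factorization p := by rw [← pow_mul, ← pow_mul, mul_comm]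
        _ ≤ _ := Nat.pow_le_pow_left (by omega) _
  calc _ ≤ ∏ p ∈ n.primeFactors, (if p < 2 ^ K then C else 1) * p ^ n.factorization p :=
        Finset.prod_le_prod' hterm
    _ = C ^ (n.primeFactors.filter (· < 2 ^ K)).card * n := by
        rw [Finset.prod_mul_distrib, ← hfac, Finset.prod_ite, Finset.prod_const,
          Finset.prod_const_one, mul_one]
    _ ≤ _ := by
        refine Nat.mul_le_mul_right _ (Nat.pow_le_pow_right hC1 ?_)
        refine (Finset.card_le_card (t := Finset.range (2 ^ K)) fun p hp => ?_).trans
          (Finset.card_range _).le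
        exact Finset.mem_range.2 (Finset.mem_filter.1 hp).2

theorem card_filter_gcd_eq_le {n g : ℕ} (hg : 0 < g) :
    ((Finset.Icc 1 n).filter fun m => n.gcd m = g).card ≤ n / g := by
  calc _ ≤ (Finset.Icc 1 (n / g)).card := by
        refine Finset.card_le_card_of_injOn (fun m => m / g) ?_ ?_
        · intro m hm
          simp only [Finset.coe_filter, Set.mem_ofPred_eq, Finset.mem_Icc] at hm
          obtain ⟨⟨h1, h2⟩, h3⟩ := hm
          simp only [Finset.coe_Icc, Set.mem_Icc]
          exact ⟨Nat.div_pos (Nat.le_of_dvd h1 (h3 ▸ Nat.gcd_dvd_right n m)) hg,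
            Nat.div_le_div_right h2⟩
        · intro m hm m' hm' h
          simp only [Finset.coe_filter, Set.mem_ofPred_eq] at hm hm'
          exact Nat.div_left_inj (hm.2 ▸ Nat.gcd_dvd_right n m)
            (hm'.2 ▸ Nat.gcd_dvd_right n m') |>.1 h
    _ = _ := by simp

/-- At most n/g values of m have gcd g, contributing n² / (n/g). The filter makes n/g at least n ^
(1/K) / 2, which absorbs the number of divisors g. -/
theorem exists_sum_gcd_sq_le (K : ℕ) (hK : K ≠ 0) :
    ∃ C : ℕ, ∀ n : ℕ, ∑ m ∈ (Finset.Icc 1 n).filter (fun m => n ≤ (2 * (n / n.gcd m)) ^ K),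
      n.gcd m ^ 2 ≤ C * n ^ 2 := by
  obtain ⟨C, hC⟩ := exists_card_divisors_pow_le K
  refine ⟨2 * C, fun n => ?_⟩
  rcases Nat.eq_zero_or_pos n with rfl | hn
  · simp
  have hfib : ∀ g ∈ n.divisors,
      ∑ m ∈ (((Finset.Icc 1 n).filter (fun m => n ≤ (2 * (n / n.gcd m)) ^ K)).filter
        fun m => n.gcd m = g), n.gcd m ^ 2 * n.divisors.card ≤ 2 * C * n ^ 2 := by
    intro g hg
    have hgn := Nat.dvd_of_mem_divisors hg
    have hg0 : 0 < g := Nat.pos_of_dvd_of_pos hgn hn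
    by_cases h : n ≤ (2 * (n / g)) ^ K
    · have hd : n.divisors.card ≤ C * (2 * (n / g)) := by
        rw [← Nat.pow_le_pow_iff_left hK]
        refine (hC n hn.ne').trans ?_
        rw [mul_pow]
        refine Nat.mul_le_mul ?_ h
        exact Nat.le_self_pow hK C
      calc _ ≤ ∑ m ∈ ((Finset.Icc 1 n).filter fun m => n.gcd m = g), g ^ 2 * n.divisors.card := by
            rw [Finset.filter_comm]
            refine (Finset.sum_le_sum_of_subset (Finset.filter_subset _ _)).trans
              (Finset.sum_le_sum fun m hm => ?_)
            rw [(Finset.mem_filter.1 hm).2]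
        _ ≤ n / g * (g ^ 2 * n.divisors.card) := by
            rw [Finset.sum_const, smul_eq_mul]
            exact Nat.mul_le_mul_right _ (card_filter_gcd_eq_le hg0)
        _ ≤ n / g * (g ^ 2 * (C * (2 * (n / g)))) := by gcongr
        _ = 2 * C * (g * (n / g)) ^ 2 := by ring
        _ = _ := by rw [Nat.mul_div_cancel' hgn]
    · rw [Finset.sum_eq_zero]
      · positivity
      · intro m hm
        simp only [Finset.mem_filter] at hm
        exact absurd (hm.2 ▸ hm.1.2) h
  have hpos : 0 < n.divisors.card := Finset.card_pos.2 ⟨1, by simp [hn.ne']⟩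
  refine Nat.le_of_mul_le_mul_right ?_ hpos
  rw [Finset.sum_mul, ← Finset.sum_fiberwise_of_maps_to (t := n.divisors) (g := fun m => n.gcd m)
    fun m _ => Nat.mem_divisors.2 ⟨Nat.gcd_dvd_left n m, hn.ne'⟩]
  refine (Finset.sum_le_card_nsmul _ _ _ hfib).trans (le_of_eq ?_)
  rw [smul_eq_mul, mul_comm]

/-- Solutions are the multiples t(n/g, m/g), g = gcd(n, m), with 1 ≤ t ≤ g. -/
theorem card_parallel_le {n m : ℕ} (hn : 0 < n) :
    (((Finset.Icc 1 n) ×ˢ (Finset.Icc 1 m)).filter fun x : ℕ × ℕ => n * x.2 = m * x.1).card ≤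
      n.gcd m := by
  have hg : 0 < n.gcd m := Nat.gcd_pos_of_pos_left m hn
  obtain ⟨n', hn'⟩ := Nat.gcd_dvd_left n m
  obtain ⟨m', hm'⟩ := Nat.gcd_dvd_right n m
  have hn'0 : 0 < n' := Nat.pos_of_ne_zero fun h => by rw [h, mul_zero] at hn'; omega
  have hcop : Nat.Coprime n' m' := by
    have := Nat.coprime_div_gcd_div_gcd hg
    rwa [Nat.div_eq_of_eq_mul_right hg hn', Nat.div_eq_of_eq_mul_right hg hm'] at this
  refine (Finset.card_le_card (t := (Finset.Icc 1 (n.gcd m)).image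
    fun t => (n' * t, m' * t)) ?_).trans (Finset.card_image_le.trans (by simp))
  rintro ⟨j, k⟩ h
  simp only [Finset.mem_filter, Finset.mem_product, Finset.mem_Icc] at h
  obtain ⟨⟨⟨hj1, hj2⟩, -⟩, h⟩ := h
  have h' : n' * k = m' * j := by
    refine Nat.eq_of_mul_eq_mul_left hg ?_
    rw [← mul_assoc, ← mul_assoc, ← hn', ← hm', h]
  obtain ⟨t, rfl⟩ := hcop.dvd_of_dvd_mul_left ⟨k, h'.symm⟩
  have hk : k = m' * t := Nat.eq_of_mul_eq_mul_left hn'0 (by rw [h']; ring)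
  refine Finset.mem_image.2 ⟨t, Finset.mem_Icc.2 ⟨?_, ?_⟩, by rw [hk]⟩
  · exact Nat.pos_of_ne_zero fun h0 => by simp [h0] at hj1
  · refine Nat.le_of_mul_le_mul_left ?_ hn'0
    rw [mul_comm n' (n.gcd m), ← hn']
    exact hj2

/-! ### Diophantine exponent and the Chung–Erdős inequality -/

/-- An irrational number that is not Liouville is badly approximable up to a power. -/
theorem exists_forall_le_abs_of_not_liouville {γ : ℝ} (hirr : Irrational γ) (hγ : ¬ Liouville γ) :
    ∃ τ : ℕ, ∀ h : ℕ, h ≠ 0 → ∀ k : ℤ, 1 ≤ (2 * h : ℝ) ^ τ * |h * γ + k| := by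
  simp only [Liouville, not_forall, not_exists, not_and, not_lt] at hγ
  obtain ⟨τ, hτ⟩ := hγ
  refine ⟨τ, fun h hh k => ?_⟩
  have hh1 : (1 : ℝ) ≤ h := by exact_mod_cast Nat.one_le_iff_ne_zero.2 hh
  -- The fraction is doubled because `Liouville` only considers denominators above 1, and h = 1 must
  -- be covered.
  have hne : γ ≠ ((-2 * k : ℤ) : ℝ) / ((2 * h : ℤ) : ℝ) := fun heq =>
    hirr ⟨((-2 * k : ℤ) : ℚ) / ((2 * h : ℤ) : ℚ), by rw [heq]; push_cast; rfl⟩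
  have h1 := hτ (-2 * k) (2 * h) (by omega) hne
  push_cast at h1
  have h2 : γ - -2 * (k : ℝ) / (2 * h) = (h * γ + k) / h := by field_simp; ring
  rw [h2, abs_div, abs_of_pos (by linarith : (0 : ℝ) < h)] at h1
  have h3 : 1 / (2 * h : ℝ) ^ τ ≤ |h * γ + k| := h1.trans (div_le_self (abs_nonneg _) hh1)
  rw [div_le_iff₀ (by positivity)] at h3
  linarith

/-- The Chung–Erdős inequality. -/
theorem sq_sum_measureReal_le {Ω ι : Type*} [MeasurableSpace Ω] (μ : Measure Ω)
    [IsProbabilityMeasure μ] (s : Finset ι) (E : ι → Set Ω) (hE : ∀ i, MeasurableSet (E i)) :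
    (∑ i ∈ s, μ.real (E i)) ^ 2 ≤
      (∑ i ∈ s, ∑ j ∈ s, μ.real (E i ∩ E j)) * μ.real (⋃ i ∈ s, E i) := by
  set U := ⋃ i ∈ s, E i with hU
  have hUm : MeasurableSet U := s.measurableSet_biUnion fun i _ => hE i
  set M := ∑ i ∈ s, μ.real (E i) with hM
  set S := ∑ i ∈ s, ∑ j ∈ s, μ.real (E i ∩ E j) with hS
  let Z : Ω → ℝ := fun ω => ∑ i ∈ s, (E i).indicator (fun _ => (1 : ℝ)) ω
  have hI : ∀ A : Set Ω, MeasurableSet A → Integrable (A.indicator fun _ => (1 : ℝ)) μ :=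
    fun A hA => (integrable_const _).indicator hA
  have hZsq : ∀ ω, Z ω ^ 2 =
      ∑ i ∈ s, ∑ j ∈ s, (E i ∩ E j).indicator (fun _ => (1 : ℝ)) ω := by
    intro ω
    rw [sq, Finset.sum_mul_sum]
    refine Finset.sum_congr rfl fun i _ => Finset.sum_congr rfl fun j _ => ?_
    rw [← Set.inter_indicator_mul]
    simp
  have hZint : Integrable Z μ := integrable_finsetSum _ fun i _ => hI _ (hE i)
  have hZsqint : Integrable (fun ω => Z ω ^ 2) μ := by
    simp only [hZsq]
    exact integrable_finsetSum _ fun i _ => integrable_finsetSum _ fun j _ =>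
      hI _ ((hE i).inter (hE j))
  have hMint : ∫ ω, Z ω ∂μ = M := by
    rw [integral_finsetSum _ fun i _ => hI _ (hE i)]
    simp [integral_indicator_const _ (hE _), hM]
  have hSint : ∫ ω, Z ω ^ 2 ∂μ = S := by
    simp only [hZsq]
    rw [integral_finsetSum _ fun i _ => integrable_finsetSum _ fun j _ =>
      hI _ ((hE i).inter (hE j))]
    refine Finset.sum_congr rfl fun i _ => ?_
    rw [integral_finsetSum _ fun j _ => hI _ ((hE i).inter (hE j))]
    simp [integral_indicator_const _ ((hE i).inter (hE _))]
  -- Integrate 2tZ - t²Z² ≤ 1 on U, where Z is supported; the discriminant gives the claim.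
  have hquad : ∀ t : ℝ, 0 ≤ S * (t * t) + (-(2 * M)) * t + μ.real U := by
    intro t
    have hle : ∫ ω, (2 * t * Z ω - t ^ 2 * Z ω ^ 2) ∂μ ≤
        ∫ ω, U.indicator (fun _ => (1 : ℝ)) ω ∂μ := by
      refine integral_mono ((hZint.const_mul _).sub (hZsqint.const_mul _)) (hI U hUm) fun ω => ?_
      by_cases hω : ω ∈ U
      · simp only [Set.indicator_of_mem hω]
        nlinarith [sq_nonneg (t * Z ω - 1)]
      · have : Z ω = 0 := Finset.sum_eq_zero fun i hi =>
          Set.indicator_of_notMem (fun h => hω (Set.mem_biUnion hi h)) _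
        simp [this, Set.indicator_of_notMem hω]
    rw [integral_sub (hZint.const_mul _) (hZsqint.const_mul _), integral_const_mul,
      integral_const_mul, hMint, hSint, integral_indicator_const _ hUm, smul_eq_mul, mul_one] at hle
    nlinarith
  have := discrim_le_zero hquad
  rw [discrim] at this
  nlinarith

/-! ### The second moment -/

theorem resonantSet_inter_nsmul (γ δ ε : ℝ) (n m : ℕ) (r : Fin 2 → ℤ) :
    resonantSet γ δ (n • r) ∩ resonantSet γ ε (m • r) =
      linForm r ⁻¹' circleOverlap γ n m δ ε := by
  have h : ∀ (l : ℕ) (α : Fin 2 → Fin 1 → UnitAddCircle),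
      linForm (l • r) α = l • linForm r α := fun l α => by
    simp only [linForm_apply, Pi.smul_apply, smul_add, smul_assoc]
  ext α
  simp only [resonantSet, circleOverlap, Set.mem_inter_iff, Set.mem_preimage, h]

/-- Here n, m are the reduced multipliers and g n, g m the original first coordinates. The error mδ
+ nε is at most n/g, while the Diophantine bound keeps it above (2n) ^ (-τ). -/
theorem le_pow_of_exists_int {γ : ℝ} {τ : ℕ}
    (hτ : ∀ h : ℕ, h ≠ 0 → ∀ k : ℤ, 1 ≤ (2 * h : ℝ) ^ τ * |h * γ + k|)
    {g n m : ℕ} (hm : 0 < m) (hmn : m < n) {δ ε : ℝ}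
    (hδ : δ ≤ 1 / (2 * (g * n : ℕ))) (hε : ε ≤ 1 / (2 * (g * m : ℕ))) (hg : 0 < g)
    (h : ∃ k : ℤ, |(n - m : ℝ) * γ + k| ≤ m * δ + n * ε) :
    g * n ≤ (2 * n) ^ (τ + 2) := by
  obtain ⟨k, hk⟩ := h
  have hg' : (0 : ℝ) < g := by exact_mod_cast hg
  have hm' : (1 : ℝ) ≤ m := by exact_mod_cast hm
  have hmn' : (m : ℝ) ≤ n := by exact_mod_cast hmn.le
  have hn' : (0 : ℝ) < n := by linarith
  have h1 := hτ (n - m) (by omega) k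
  rw [Nat.cast_sub hmn.le] at h1
  have h2 : m * δ + n * ε ≤ n / g := by
    push_cast at hδ hε
    have h3 : m * δ ≤ n * (1 / (2 * g)) := by
      calc m * δ ≤ m * (1 / (2 * (g * n))) := mul_le_mul_of_nonneg_left hδ (by linarith)
        _ ≤ n * (1 / (2 * g)) := by
          refine mul_le_mul hmn' ?_ (by positivity) hn'.le
          refine one_div_le_one_div_of_le (by positivity) ?_
          nlinarith
    have h4 : n * ε ≤ n * (1 / (2 * g)) := by
      refine mul_le_mul_of_nonneg_left (hε.trans ?_) hn'.le
      refine one_div_le_one_div_of_le (by positivity) ?_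
      nlinarith
    have h5 : (n : ℝ) / g = n * (1 / (2 * g)) + n * (1 / (2 * g)) := by field_simp; ring
    linarith
  have h3 : (1 : ℝ) ≤ (2 * n) ^ τ * (n / g) := by
    refine h1.trans (mul_le_mul ?_ (hk.trans h2) (abs_nonneg _) (by positivity))
    exact pow_le_pow_left₀ (by linarith) (by linarith) _
  rw [← mul_div_assoc, le_div_iff₀ hg', one_mul] at h3
  have h4 : (g * n : ℝ) ≤ (2 * n) ^ (τ + 2) := by
    calc (g * n : ℝ) ≤ (2 * n) ^ τ * n * n := mul_le_mul_of_nonneg_right h3 hn'.le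
      _ ≤ (2 * n) ^ τ * (2 * n) * (2 * n) := by gcongr <;> linarith
      _ = _ := by ring
  exact_mod_cast h4

theorem volume_real_resonantSet_inter_le {γ : ℝ} {τ : ℕ}
    (hτ : ∀ h : ℕ, h ≠ 0 → ∀ k : ℤ, 1 ≤ (2 * h : ℝ) ^ τ * |h * γ + k|)
    {n m : ℕ} (hm : 0 < m) (hmn : m ≤ n) {j k : ℕ} {δ ε : ℝ} (hδ0 : 0 ≤ δ) (hε0 : 0 ≤ ε)
    (hδ : δ ≤ 1 / (2 * n)) (hε : ε ≤ 1 / (2 * m)) :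
    volume.real (resonantSet γ δ ![n, j] ∩ resonantSet γ ε ![m, k]) ≤ 4 * δ * ε +
      if n * k = m * j ∧ (m = n ∨ n ≤ (2 * (n / n.gcd m)) ^ (τ + 2)) then
        2 * δ * n.gcd m / n else 0 := by
  have hn : 0 < n := hm.trans_le hmn
  have hn' : (0 : ℝ) < n := by exact_mod_cast hn
  by_cases hpar : n * k = m * j
  swap
  · rw [if_neg fun h => hpar h.1, Measure.real, volume_resonantSet_inter, ENNReal.toReal_mul,
      ENNReal.toReal_ofReal (by positivity), ENNReal.toReal_ofReal (by positivity)]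
    · calc _ ≤ (2 * δ) * (2 * ε) :=
            mul_le_mul (min_le_right _ _) (min_le_right _ _) (by positivity) (by positivity)
        _ = _ := by ring
    · simp only [Matrix.cons_val_zero, Matrix.cons_val_one]
      intro h
      apply hpar
      zify
      linarith
  have hg : 0 < n.gcd m := Nat.gcd_pos_of_pos_left m hn
  obtain ⟨n', hn1⟩ := Nat.gcd_dvd_left n m
  obtain ⟨m', hm1⟩ := Nat.gcd_dvd_right n m
  have hdn : n / n.gcd m = n' := Nat.div_eq_of_eq_mul_right hg hn1
  have hdm : m / n.gcd m = m' := Nat.div_eq_of_eq_mul_right hg hm1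
  have hcop : Nat.Coprime n' m' := by
    have := Nat.coprime_div_gcd_div_gcd hg
    rwa [hdn, hdm] at this
  rw [hdn]
  set g := n.gcd m with hgdef
  have hn'0 : 0 < n' := Nat.pos_of_ne_zero fun h => by rw [h, mul_zero] at hn1; omega
  have hm'0 : 0 < m' := Nat.pos_of_ne_zero fun h => by rw [h, mul_zero] at hm1; omega
  have hpar' : n' * k = m' * j := by
    refine Nat.eq_of_mul_eq_mul_left hg ?_
    rw [← mul_assoc, ← mul_assoc, ← hn1, ← hm1, hpar]
  obtain ⟨t, ht⟩ := hcop.dvd_of_dvd_mul_left ⟨k, hpar'.symm⟩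
  have hk : k = m' * t := Nat.eq_of_mul_eq_mul_left hn'0 (by rw [hpar', ht]; ring)
  have hr : (![(g : ℤ), (t : ℤ)] : Fin 2 → ℤ) ≠ 0 := fun h => by
    have := congrFun h 0
    simp at this
    omega
  have e1 : (![(n : ℤ), (j : ℤ)] : Fin 2 → ℤ) = n' • ![(g : ℤ), (t : ℤ)] := by
    ext i
    fin_cases i
    · simp only [Fin.zero_eta, Matrix.cons_val_zero, Pi.smul_apply, nsmul_eq_mul]
      rw [hn1]; push_cast; ring
    · simp [ht]
  have e2 : (![(m : ℤ), (k : ℤ)] : Fin 2 → ℤ) = m' • ![(g : ℤ), (t : ℤ)] := by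
    ext i
    fin_cases i
    · simp only [Fin.zero_eta, Matrix.cons_val_zero, Pi.smul_apply, nsmul_eq_mul]
      rw [hm1]; push_cast; ring
    · simp [hk]
  have hvol : volume.real (resonantSet γ δ ![(n : ℤ), (j : ℤ)] ∩
      resonantSet γ ε ![(m : ℤ), (k : ℤ)]) = volume.real (circleOverlap γ n' m' δ ε) := by
    rw [e1, e2, resonantSet_inter_nsmul, Measure.real,
      (measurePreserving_linForm hr).measure_preimage
        (measurableSet_circleOverlap γ n' m' δ ε).nullMeasurableSet, Measure.real]
  rw [hvol]
  rcases (circleOverlap γ n' m' δ ε).eq_empty_or_nonempty with hem | hne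
  · rw [hem, measureReal_empty]
    positivity
  have hcond : m = n ∨ n ≤ (2 * n') ^ (τ + 2) := by
    rcases hmn.eq_or_lt with h | h
    · exact Or.inl h
    · right
      have := le_pow_of_exists_int hτ (g := g) hm'0 (Nat.lt_of_mul_lt_mul_left
        (a := g) (by rw [← hn1, ← hm1]; exact h)) (by rwa [← hn1]) (by rwa [← hm1]) hg
        (exists_int_of_circleOverlap_nonempty hne)
      rwa [← hn1] at this
  rw [if_pos ⟨hpar, hcond⟩]
  have hov := volume_circleOverlap_le hn'0 hcop γ hδ0 hε0
  have hn'r : (0 : ℝ) < n' := by exact_mod_cast hn'0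
  have hgr : (0 : ℝ) < g := by exact_mod_cast hg
  have hnr : (n : ℝ) = g * n' := by exact_mod_cast hn1
  have h3 : 2 * δ * g / n = 2 * δ / n' := by rw [hnr]; field_simp
  rw [h3]
  refine le_of_mul_le_mul_left (hov.trans (le_of_eq ?_)) hn'r
  field_simp
  ring

theorem sum_volume_real_resonantSet_inter_le {γ : ℝ} {τ : ℕ}
    (hτ : ∀ h : ℕ, h ≠ 0 → ∀ k : ℤ, 1 ≤ (2 * h : ℝ) ^ τ * |h * γ + k|)
    {n m : ℕ} (hm : 0 < m) (hmn : m ≤ n) {δ ε : ℝ} (hδ0 : 0 ≤ δ) (hε0 : 0 ≤ ε)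
    (hδ : δ ≤ 1 / (2 * n)) (hε : ε ≤ 1 / (2 * m)) :
    ∑ j ∈ Finset.Icc 1 n, ∑ k ∈ Finset.Icc 1 m,
      volume.real (resonantSet γ δ ![(n : ℤ), (j : ℤ)] ∩ resonantSet γ ε ![(m : ℤ), (k : ℤ)]) ≤
        (2 * n * δ) * (2 * m * ε) + if m = n ∨ n ≤ (2 * (n / n.gcd m)) ^ (τ + 2) then
          2 * δ / n * n.gcd m ^ 2 else 0 := by
  have hn : 0 < n := hm.trans_le hmn
  refine (Finset.sum_le_sum fun j _ => Finset.sum_le_sum fun k _ =>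
    volume_real_resonantSet_inter_le hτ hm hmn hδ0 hε0 hδ hε).trans ?_
  simp only [Finset.sum_add_distrib, Finset.sum_const, Nat.card_Icc, add_tsub_cancel_right,
    nsmul_eq_mul]
  refine add_le_add (le_of_eq (by ring)) ?_
  split_ifs with h
  · simp only [h, and_true]
    rw [← Finset.sum_product', ← Finset.sum_filter, Finset.sum_const, nsmul_eq_mul]
    calc _ ≤ (n.gcd m : ℝ) * (2 * δ * n.gcd m / n) := by
          refine mul_le_mul_of_nonneg_right ?_ (by positivity)
          exact_mod_cast card_parallel_le hn
      _ = _ := by ring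
  · simp [h]

theorem exists_second_moment_le {γ : ℝ} (hirr : Irrational γ) (hγ : ¬ Liouville γ) :
    ∃ C : ℝ, 0 ≤ C ∧ ∀ φ : ℕ → ℝ, (∀ n, 0 ≤ φ n) → (∀ n : ℕ, φ n ≤ 1 / (2 * n)) →
      ∀ s : Finset ℕ, (∀ n ∈ s, 0 < n) →
        ∑ n ∈ s, ∑ m ∈ s, ∑ j ∈ Finset.Icc 1 n, ∑ k ∈ Finset.Icc 1 m,
          volume.real (resonantSet γ (φ n) ![(n : ℤ), (j : ℤ)] ∩
            resonantSet γ (φ m) ![(m : ℤ), (k : ℤ)]) ≤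
        (∑ n ∈ s, 2 * n * φ n) ^ 2 + C * ∑ n ∈ s, 2 * n * φ n := by
  obtain ⟨τ, hτ⟩ := exists_forall_le_abs_of_not_liouville hirr hγ
  obtain ⟨C, hC⟩ := exists_sum_gcd_sq_le (τ + 2) (by omega)
  refine ⟨2 * (1 + C), by positivity, fun φ hφ0 hφ s hs => ?_⟩
  -- The excess of a pair is charged to its larger index, so `e n m + e m n` covers both orders.
  let e : ℕ → ℕ → ℝ := fun n m =>
    if m ≤ n ∧ (m = n ∨ n ≤ (2 * (n / n.gcd m)) ^ (τ + 2)) then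
      2 * φ n / n * n.gcd m ^ 2 else 0
  have he0 : ∀ n m, 0 ≤ e n m := fun n m => by
    have := hφ0 n
    simp only [e]
    positivity
  have hpair : ∀ n ∈ s, ∀ m ∈ s, ∑ j ∈ Finset.Icc 1 n, ∑ k ∈ Finset.Icc 1 m,
      volume.real (resonantSet γ (φ n) ![(n : ℤ), (j : ℤ)] ∩
        resonantSet γ (φ m) ![(m : ℤ), (k : ℤ)]) ≤
      (2 * n * φ n) * (2 * m * φ m) + (e n m + e m n) := by
    intro n hn m hm
    rcases le_total m n with h | h
    · refine (sum_volume_real_resonantSet_inter_le hτ (hs m hm) h (hφ0 n) (hφ0 m)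
        (hφ n) (hφ m)).trans (add_le_add le_rfl ?_)
      refine le_trans (le_of_eq ?_) (le_add_of_nonneg_right (he0 m n))
      simp only [e, h, true_and]
    · rw [Finset.sum_comm]
      simp only [Set.inter_comm (resonantSet γ (φ n) _)]
      refine (sum_volume_real_resonantSet_inter_le hτ (hs n hn) h (hφ0 m) (hφ0 n)
        (hφ m) (hφ n)).trans (add_le_add (mul_comm _ _).le ?_)
      refine le_trans (le_of_eq ?_) (le_add_of_nonneg_left (he0 n m))
      simp only [e, h, true_and]
  have hrow : ∀ n ∈ s, ∑ m ∈ s, e n m ≤ (1 + C) * (2 * n * φ n) := by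
    intro n hn
    have hn0 : (0 : ℝ) < n := by exact_mod_cast hs n hn
    have hcoef : 0 ≤ 2 * φ n / n := div_nonneg (mul_nonneg zero_le_two (hφ0 n)) hn0.le
    -- The diagonal m = n costs n², the other m at most C n².
    have hnat : ∑ m ∈ s.filter (fun m => m ≤ n ∧ (m = n ∨ n ≤ (2 * (n / n.gcd m)) ^ (τ + 2))),
        n.gcd m ^ 2 ≤ (1 + C) * n ^ 2 := by
      calc _ ≤ ∑ m ∈ {n} ∪ (Finset.Icc 1 n).filter
              (fun m => n ≤ (2 * (n / n.gcd m)) ^ (τ + 2)), n.gcd m ^ 2 := by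
            refine Finset.sum_le_sum_of_subset fun m hm => ?_
            simp only [Finset.mem_filter, Finset.mem_union, Finset.mem_singleton,
              Finset.mem_Icc] at hm ⊢
            rcases hm.2.2 with h | h
            · exact Or.inl h
            · exact Or.inr ⟨⟨hs m hm.1, hm.2.1⟩, h⟩
        _ ≤ n.gcd n ^ 2 + C * n ^ 2 := by
            have := Finset.sum_union_inter (s₁ := {n}) (s₂ := (Finset.Icc 1 n).filter
              (fun m => n ≤ (2 * (n / n.gcd m)) ^ (τ + 2))) (f := fun m => n.gcd m ^ 2)
            rw [Finset.sum_singleton] at this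
            have := hC n
            omega
        _ = _ := by rw [Nat.gcd_self]; ring
    simp only [e]
    rw [← Finset.sum_filter, ← Finset.mul_sum]
    calc _ ≤ 2 * φ n / n * ((1 + C) * n ^ 2) := by
          refine mul_le_mul_of_nonneg_left ?_ hcoef
          exact_mod_cast hnat
      _ = _ := by field_simp
  calc _ ≤ ∑ n ∈ s, ∑ m ∈ s, ((2 * n * φ n) * (2 * m * φ m) + (e n m + e m n)) :=
        Finset.sum_le_sum fun n hn => Finset.sum_le_sum fun m hm => hpair n hn m hm
    _ = (∑ n ∈ s, 2 * n * φ n) ^ 2 + 2 * ∑ n ∈ s, ∑ m ∈ s, e n m := by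
        simp only [Finset.sum_add_distrib]
        rw [sq, Finset.sum_mul_sum, Finset.sum_comm (f := fun n m => e m n)]
        ring
    _ ≤ _ := by
        have := Finset.sum_le_sum hrow
        rw [← Finset.mul_sum] at this
        linarith

/-! ### The divergence case -/

/-- Where the truncation is active the term equals 1, so a convergent truncated series is eventually
untruncated. -/
theorem not_summable_mul_min {ψ : ℕ → ℝ≥0} (h : ¬ Summable fun q : ℕ => (q : ℝ≥0) * ψ q) :
    ¬ Summable fun n : ℕ => 2 * (n : ℝ) * min (ψ n : ℝ) (1 / (2 * n)) := by
  contrapose! h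
  rw [← NNReal.summable_coe]
  have hlt : ∀ᶠ n : ℕ in Filter.cofinite, 2 * (n : ℝ) * min (ψ n : ℝ) (1 / (2 * n)) < 1 :=
    h.tendsto_cofinite_zero.eventually (gt_mem_nhds one_pos)
  refine (summable_congr_cofinite ?_).1 (h.mul_left (1 / 2))
  filter_upwards [hlt, (Set.finite_singleton 0).eventually_cofinite_notMem] with n hn hn0
  have hn0 : (0 : ℝ) < n := by
    exact_mod_cast Nat.pos_of_ne_zero hn0
  have hmin : min (ψ n : ℝ) (1 / (2 * n)) = ψ n := by
    refine min_eq_left ?_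
    by_contra! hlt'
    rw [min_eq_right hlt'.le] at hn
    field_simp at hn
    exact lt_irrefl _ hn
  rw [hmin]
  push_cast
  ring

/-- If the union had measure u < 1, then μ² ≤ (μ² + Cμ)u would bound every partial sum μ of the tail
by C / (1 - u). -/
theorem volume_real_iUnion_resonantSet_eq_one {γ : ℝ} (hirr : Irrational γ) (hγ : ¬ Liouville γ)
    {φ : ℕ → ℝ} (hφ0 : ∀ n, 0 ≤ φ n) (hφ : ∀ n : ℕ, φ n ≤ 1 / (2 * n))
    (hsum : ¬ Summable fun n : ℕ => 2 * (n : ℝ) * φ n) (N : ℕ) :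
    volume.real (⋃ x ∈ {x : ℕ × ℕ | N < x.1 ∧ x.2 ≤ x.1},
      resonantSet γ (φ x.1) ![(x.1 : ℤ), (x.2 : ℤ)]) = 1 := by
  set U := ⋃ x ∈ {x : ℕ × ℕ | N < x.1 ∧ x.2 ≤ x.1},
      resonantSet γ (φ x.1) ![(x.1 : ℤ), (x.2 : ℤ)] with hU
  obtain ⟨C, hC0, hC⟩ := exists_second_moment_le hirr hγ
  refine le_antisymm measureReal_le_one ?_
  by_contra! hlt
  have hsum' : ¬ Summable fun n : ℕ => 2 * ((n + (N + 1) : ℕ) : ℝ) * φ (n + (N + 1)) :=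
    fun h => hsum ((summable_nat_add_iff (f := fun n : ℕ => 2 * (n : ℝ) * φ n) (N + 1)).1 h)
  have hp := measureReal_nonneg (μ := volume) (s := U)
  refine hsum' (summable_of_sum_range_le (c := C / (1 - volume.real U))
    (fun n => mul_nonneg (by positivity) (hφ0 _)) fun k => ?_)
  set s : Finset ℕ := (Finset.range k).map (addRightEmbedding (N + 1)) with hs
  have hsN : ∀ n ∈ s, N < n := fun n hn => by
    simp only [hs, Finset.mem_map, addRightEmbedding_apply] at hn
    obtain ⟨i, -, rfl⟩ := hn
    omega
  have hμ : ∑ i ∈ Finset.range k, 2 * ((i + (N + 1) : ℕ) : ℝ) * φ (i + (N + 1)) =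
      ∑ n ∈ s, 2 * (n : ℝ) * φ n := by
    rw [hs, Finset.sum_map]
    rfl
  rw [hμ]
  set μ := ∑ n ∈ s, 2 * (n : ℝ) * φ n with hμdef
  have hμ0 : 0 ≤ μ := Finset.sum_nonneg fun n _ => mul_nonneg (by positivity) (hφ0 n)
  have hCE := sq_sum_measureReal_le volume (s.sigma fun n => Finset.Icc 1 n)
    (fun x => resonantSet γ (φ x.1) ![(x.1 : ℤ), (x.2 : ℤ)])
    fun x => measurableSet_resonantSet _ _ _
  simp only [Finset.sum_sigma] at hCE
  have hfirst : ∑ n ∈ s, ∑ j ∈ Finset.Icc 1 n,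
      volume.real (resonantSet γ (φ n) ![(n : ℤ), (j : ℤ)]) = μ := by
    refine Finset.sum_congr rfl fun n hn => ?_
    have hn0 : 0 < n := (Nat.zero_le N).trans_lt (hsN n hn)
    have hv : ∀ j : ℕ, volume.real (resonantSet γ (φ n) ![(n : ℤ), (j : ℤ)]) = 2 * φ n := by
      intro j
      rw [Measure.real, volume_resonantSet γ (φ n) (fun h => by
        have := congrFun h 0
        simp at this
        omega), min_eq_right, ENNReal.toReal_ofReal (mul_nonneg zero_le_two (hφ0 n))]
      have h1 : (1 : ℝ) ≤ n := by exact_mod_cast hn0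
      have h2 := hφ n
      rw [le_div_iff₀ (by positivity)] at h2
      nlinarith [hφ0 n]
    simp only [hv, Finset.sum_const, Nat.card_Icc, add_tsub_cancel_right, nsmul_eq_mul]
    ring
  have hsecond : ∑ n ∈ s, ∑ j ∈ Finset.Icc 1 n, ∑ m ∈ s, ∑ k ∈ Finset.Icc 1 m,
      volume.real (resonantSet γ (φ n) ![(n : ℤ), (j : ℤ)] ∩
        resonantSet γ (φ m) ![(m : ℤ), (k : ℤ)]) ≤ μ ^ 2 + C * μ := by
    refine le_trans (le_of_eq ?_) (hC φ hφ0 hφ s fun n hn => (Nat.zero_le N).trans_lt (hsN n hn))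
    exact Finset.sum_congr rfl fun n _ => Finset.sum_comm
  have hUle : volume.real (⋃ x ∈ s.sigma fun n => Finset.Icc 1 n,
      resonantSet γ (φ x.1) ![(x.1 : ℤ), (x.2 : ℤ)]) ≤ volume.real U := by
    refine measureReal_mono (Set.iUnion₂_subset fun x hx => ?_) (measure_ne_top _ _)
    rw [Finset.mem_sigma, Finset.mem_Icc] at hx
    exact Set.subset_biUnion_of_mem (u := fun x : ℕ × ℕ =>
      resonantSet γ (φ x.1) ![(x.1 : ℤ), (x.2 : ℤ)]) (x := (x.1, x.2)) ⟨hsN _ hx.1, hx.2.2⟩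
  have hmain : μ ^ 2 ≤ (μ ^ 2 + C * μ) * volume.real U := by
    rw [hfirst] at hCE
    exact hCE.trans (mul_le_mul hsecond hUle measureReal_nonneg (by positivity))
  rw [le_div_iff₀ (by linarith)]
  rcases hμ0.eq_or_lt with h0 | h0
  · rw [← h0, zero_mul]
    exact hC0
  · have h1 : μ ≤ (μ + C) * volume.real U := by
      refine le_of_mul_le_mul_left ?_ h0
      linarith
    nlinarith

theorem volume_approxSet_eq_one {γ : ℝ} (hirr : Irrational γ) (hγ : ¬ Liouville γ)
    {ψ : ℕ → ℝ≥0} (h : ¬ Summable fun q : ℕ => (q : ℝ≥0) * ψ q) :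
    volume (approxSet 2 1 ψ fun _ => γ) = 1 := by
  let φ : ℕ → ℝ := fun n => min (ψ n : ℝ) (1 / (2 * n))
  have hone := volume_real_iUnion_resonantSet_eq_one hirr hγ (φ := φ)
    (fun n => le_min (ψ n).coe_nonneg (by positivity)) (fun n => min_le_right _ _)
    (not_summable_mul_min h)
  have hae : ∀ᵐ α : Fin 2 → Fin 1 → UnitAddCircle, α ∈ approxSet 2 1 ψ fun _ => γ := by
    have hall : ∀ᵐ α : Fin 2 → Fin 1 → UnitAddCircle, ∀ N : ℕ,
        α ∈ ⋃ x ∈ {x : ℕ × ℕ | N < x.1 ∧ x.2 ≤ x.1},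
          resonantSet γ (φ x.1) ![(x.1 : ℤ), (x.2 : ℤ)] := by
      refine ae_all_iff.2 fun N => ?_
      have hm : MeasurableSet (⋃ x ∈ {x : ℕ × ℕ | N < x.1 ∧ x.2 ≤ x.1},
          resonantSet γ (φ x.1) ![(x.1 : ℤ), (x.2 : ℤ)]) :=
        MeasurableSet.biUnion (Set.to_countable _) fun x _ => measurableSet_resonantSet _ _ _
      refine (mem_ae_iff_prob_eq_one hm).2 ?_
      exact (ENNReal.toReal_eq_one_iff _).1 (hone N)
    filter_upwards [hall] with α hα
    refine mem_approxSet_of_frequently fun N => ?_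
    obtain ⟨⟨n, j⟩, ⟨hN, hj⟩, hmem⟩ := Set.mem_iUnion₂.1 (hα N)
    have hnorm : intVecNorm ![(n : ℤ), (j : ℤ)] = n := by
      rw [intVecNorm_two]
      simpa using hj
    refine ⟨![(n : ℤ), (j : ℤ)], by rw [hnorm]; exact hN.le, ?_⟩
    rw [hnorm]
    exact Metric.closedBall_subset_closedBall (min_le_left _ _) hmem
  -- A null complement suffices, so measurability of `approxSet` is not needed.
  exact (measure_eq_measure_of_null_sdiff (Set.subset_univ _)
    (by rw [← Set.compl_eq_univ_sdiff]; exact hae)).trans measure_univ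

theorem theorem1 (γ : ℝ) (hirr : Irrational γ) (hγ : ¬ Liouville γ) (ψ : ℕ → ℝ≥0) :
    ((Summable fun q : ℕ => (q : ℝ≥0) * ψ q) →
      volume (approxSet 2 1 ψ fun _ => γ) = 0) ∧
    ((¬ Summable fun q : ℕ => (q : ℝ≥0) * ψ q) →
      volume (approxSet 2 1 ψ fun _ => γ) = 1) :=
  ⟨volume_approxSet_eq_zero γ, volume_approxSet_eq_one hirr hγ⟩
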